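/- Let $\beta\in(1,2)$ and $\tau\in(0,1/2)$, and let $f:[0,1]^2\to[0,1]^2$ be the map \[ f(x,y)=\begin{cases}(\beta x,\ \tau y), & x\in[0,\beta^{-1}],\\ (\beta x-1,\ \tau y+(1-\tau)), & x\in(\beta^{-1},1].\end{cases} \] Let $\Lambda_{\beta,\tau}=\overline{\bigcap_{i=0}^{\infty}f^i([0,1]^2)}\subset\mathbb{R}^2$ be its attractor. Then the Hausdorff dimension of $\Lambda_{\beta,\tau}$ is \[ \dim_H\Lambda_{\beta,\tau}=1+\frac{\log\beta}{\log\tau^{-1}}. \] -/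

import Mathlib

/-- The closed unit square `[0,1]²` in the Euclidean plane. -/
def unitSquare : Set (EuclideanSpace ℝ (Fin 2)) :=
  {p | p 0 ∈ Set.Icc (0 : ℝ) 1 ∧ p 1 ∈ Set.Icc (0 : ℝ) 1}

/-- The piecewise affine map `f(x, y) = (βx, τy)` for `x ≤ β⁻¹` and
`f(x, y) = (βx - 1, τy + (1 - τ))` for `x > β⁻¹`. It is only ever applied to points of the unit
square, which it maps into itself (`mapsTo_betaMap_unitSquare`). -/
noncomputable def betaMap (β τ : ℝ) (p : EuclideanSpace ℝ (Fin 2)) : EuclideanSpace ℝ (Fin 2) :=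
  if p 0 ≤ β⁻¹ then !₂[β * p 0, τ * p 1]
  else !₂[β * p 0 - 1, τ * p 1 + (1 - τ)]

/-- The attractor: the closure of the intersection of all forward images of the unit square. -/
noncomputable def betaAttractor (β τ : ℝ) : Set (EuclideanSpace ℝ (Fin 2)) :=
  closure (⋂ i : ℕ, (betaMap β τ)^[i] '' unitSquare)

/-- The map is a self-map of the unit square for the parameters considered. -/
theorem mapsTo_betaMap_unitSquare {β τ : ℝ} (hβ : β ∈ Set.Ioo (1 : ℝ) 2)
    (hτ : τ ∈ Set.Ioo (0 : ℝ) (1 / 2)) :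
    Set.MapsTo (betaMap β τ) unitSquare unitSquare := by
  obtain ⟨hβ1, hβ2⟩ := hβ
  obtain ⟨hτ1, hτ2⟩ := hτ
  rintro p ⟨⟨hx0, hx1⟩, hy0, hy1⟩
  have hβ0 : 0 < β := by linarith
  have hc : β * β⁻¹ = 1 := mul_inv_cancel₀ hβ0.ne'
  unfold betaMap
  split_ifs with h
  · refine ⟨⟨?_, ?_⟩, ?_, ?_⟩ <;> simp <;> nlinarith
  · push Not at h
    refine ⟨⟨?_, ?_⟩, ?_, ?_⟩ <;> simp <;> nlinarith

/-!
Up to left edges, the `n`-th image of the unit square is a union of strips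
`[0, a] × [b, b + τ ^ n]`. The widths `a` are at most `1`, they add up to `β ^ n`, and at each step
a strip is either stretched by `β` or cut into two strips, the left one of full width `1`.

For the upper bound, cut the strips into squares of side `τ ^ n`. There are at most
`2 ^ n ≤ (β / τ) ^ n` strips, so about `(β / τ) ^ n` squares suffice.

For the lower bound, there are at least `β ^ n` strips since the widths are at most `1`. Each cut
creates a strip of full width, so for every `γ < β` some image, say the `k`-th, contains at least
`γ ^ k` strips of full width. These can be iterated freely: the attractor contains `(0, 1] × K` for
a self-similar set `K` generated by at least `γ ^ k` maps of ratio `τ ^ k` whose images do not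
overlap. The product of Lebesgue measure and of the uniform Bernoulli measure on `K` then gives
dimension at least `1 + log γ / log τ⁻¹` by the mass distribution principle; finally `γ → β`.
-/

open MeasureTheory Filter Topology
open scoped ENNReal

section DimensionBounds

variable {X : Type*} [EMetricSpace X] {S : Set X} {ρ D d : ℝ}

theorem dimH_le_of_finite_covers {C : ℝ} (hρ0 : 0 ≤ ρ) (hρ1 : ρ < 1) (hd : 0 ≤ d)
    (hcover : ∀ n : ℕ, ∃ 𝒰 : Finset (Set X), S ⊆ ⋃ U ∈ 𝒰, U ∧
      (∀ U ∈ 𝒰, Metric.ediam U ≤ ENNReal.ofReal (C * ρ ^ n)) ∧ 𝒰.card * (ρ ^ n) ^ d ≤ D) :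
    dimH S ≤ ENNReal.ofReal d := by
  borelize X
  choose 𝒰 hS hdiam hcard using hcover
  have hmesh : Tendsto (fun n : ℕ => ENNReal.ofReal (C * ρ ^ n)) atTop (𝓝 0) := by
    simpa using ENNReal.tendsto_ofReal
      ((tendsto_pow_atTop_nhds_zero_of_lt_one hρ0 hρ1).const_mul C)
  have hsum (n : ℕ) : ∑ U : 𝒰 n, Metric.ediam U.1 ^ d ≤ ENNReal.ofReal C ^ d * ENNReal.ofReal D :=
    calc ∑ U : 𝒰 n, Metric.ediam U.1 ^ d
        ≤ ∑ _U : 𝒰 n, ENNReal.ofReal (C * ρ ^ n) ^ d := by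
          gcongr with U
          exact hdiam n U U.2
      _ = ENNReal.ofReal C ^ d * ENNReal.ofReal ((𝒰 n).card * (ρ ^ n) ^ d) := by
          rw [Finset.sum_const, Finset.card_univ, Fintype.card_coe, nsmul_eq_mul,
            ENNReal.ofReal_mul' (pow_nonneg hρ0 n), ENNReal.mul_rpow_of_nonneg _ _ hd,
            ENNReal.ofReal_rpow_of_nonneg (pow_nonneg hρ0 n) hd,
            ENNReal.ofReal_mul (Nat.cast_nonneg _), ENNReal.ofReal_natCast, mul_left_comm]
      _ ≤ ENNReal.ofReal C ^ d * ENNReal.ofReal D := by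
          gcongr
          exact hcard n
  have hmeasure : μH[d] S ≤ ENNReal.ofReal C ^ d * ENNReal.ofReal D :=
    (Measure.hausdorffMeasure_le_liminf_sum d S _ hmesh (fun n (U : 𝒰 n) => U.1)
      (.of_forall fun n U => hdiam n U U.2)
      (.of_forall fun n => by simpa [Set.iUnion_subtype] using hS n)).trans
    (liminf_le_of_frequently_le' (Frequently.of_forall hsum))
  refine dimH_le_of_hausdorffMeasure_ne_top (d := d.toNNReal) ?_
  rw [Real.coe_toNNReal d hd]
  exact ne_top_of_le_ne_top (by finiteness) hmeasure

variable [MeasurableSpace X] {μ : Measure X}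

theorem measure_le_mul_ediam_rpow (hρ0 : 0 < ρ) (hρ1 : ρ < 1) (hd : 0 < d)
    (hμ : ∀ (n : ℕ) (E : Set X), Metric.ediam E ≤ ENNReal.ofReal (ρ ^ n) →
      μ E ≤ ENNReal.ofReal (D * (ρ ^ n) ^ d))
    {E : Set X} (hE : Metric.ediam E ≤ 1) :
    μ E ≤ ENNReal.ofReal (D / ρ ^ d) * Metric.ediam E ^ d := by
  obtain ⟨r, hr0, hr⟩ : ∃ r : ℝ, 0 ≤ r ∧ Metric.ediam E = ENNReal.ofReal r :=
    ⟨_, ENNReal.toReal_nonneg, (ENNReal.ofReal_toReal (ne_top_of_le_ne_top (by simp) hE)).symm⟩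
  rw [hr, ENNReal.ofReal_rpow_of_nonneg hr0 hd.le]
  rcases hr0.eq_or_lt with rfl | hr0
  · have hlim : Tendsto (fun n : ℕ => ENNReal.ofReal (D * (ρ ^ n) ^ d)) atTop (𝓝 0) := by
      simp_rw [← Real.rpow_pow_comm hρ0.le]
      simpa using ENNReal.tendsto_ofReal ((tendsto_pow_atTop_nhds_zero_of_lt_one
        (by positivity) (Real.rpow_lt_one hρ0.le hρ1 hd)).const_mul D)
    have hzero : μ E ≤ 0 := ge_of_tendsto' hlim fun n => hμ n E (by simp [hr])
    exact hzero.trans zero_le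
  · rw [hr, ENNReal.ofReal_le_one] at hE
    obtain ⟨n, hlow, hupp⟩ := exists_nat_pow_near_of_lt_one hr0 hE hρ0 hρ1
    have hscale : ρ ^ n ≤ r / ρ := (le_div_iff₀ hρ0).2 (pow_succ ρ n ▸ hlow.le)
    calc μ E ≤ ENNReal.ofReal (D * (ρ ^ n) ^ d) :=
          hμ n E (hr.trans_le (ENNReal.ofReal_le_ofReal hupp))
      _ = ENNReal.ofReal D * ENNReal.ofReal ((ρ ^ n) ^ d) := ENNReal.ofReal_mul' (by positivity)
      _ ≤ ENNReal.ofReal D * ENNReal.ofReal ((r / ρ) ^ d) := by gcongr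
      _ = ENNReal.ofReal (D / ρ ^ d) * ENNReal.ofReal (r ^ d) := by
          rw [← ENNReal.ofReal_mul' (by positivity), ← ENNReal.ofReal_mul' (by positivity),
            Real.div_rpow hr0.le hρ0.le, mul_div_left_comm, mul_comm, mul_comm_div, mul_div_assoc']

theorem le_dimH_of_measure_le_rpow [BorelSpace X] (hρ0 : 0 < ρ) (hρ1 : ρ < 1)
    (hμ : ∀ (n : ℕ) (E : Set X), Metric.ediam E ≤ ENNReal.ofReal (ρ ^ n) →
      μ E ≤ ENNReal.ofReal (D * (ρ ^ n) ^ d))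
    (hS : μ S ≠ 0) : ENNReal.ofReal d ≤ dimH S := by
  rcases le_or_gt d 0 with hd | hd
  · simp [ENNReal.ofReal_of_nonpos hd]
  set K := ENNReal.ofReal (D / ρ ^ d)
  have hle : (K + 1)⁻¹ • μ ≤ μH[d] := by
    refine Measure.le_hausdorffMeasure _ _ 1 one_pos fun E hE => ?_
    rw [Measure.smul_apply, smul_eq_mul,
      ENNReal.inv_mul_le_iff (by simp) (by finiteness)]
    exact (measure_le_mul_ediam_rpow hρ0 hρ1 hd hμ hE).trans (by gcongr; exact le_self_add)
  refine le_dimH_of_hausdorffMeasure_ne_zero (d := d.toNNReal) ?_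
  rw [Real.coe_toNNReal d hd.le]
  refine ((ENNReal.mul_pos ?_ hS).trans_le (Measure.le_iff'.1 hle S)).ne'
  exact ENNReal.inv_ne_zero.2 (by finiteness)

end DimensionBounds

section Plane

/-- The product `I × J`, as a subset of the Euclidean plane. -/
def planeProd (I J : Set ℝ) : Set (EuclideanSpace ℝ (Fin 2)) :=
  {p | p 0 ∈ I ∧ p 1 ∈ J}

theorem isClosed_planeProd {I J : Set ℝ} (hI : IsClosed I) (hJ : IsClosed J) :
    IsClosed (planeProd I J) :=
  (hI.preimage (by fun_prop)).inter (hJ.preimage (by fun_prop))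

theorem ediam_planeProd_Icc_le (x y δ : ℝ) :
    Metric.ediam (planeProd (Set.Icc x (x + δ)) (Set.Icc y (y + δ))) ≤
      ENNReal.ofReal (2 * δ) := by
  refine Metric.ediam_le fun p hp q hq => ?_
  have h0 : |p 0 - q 0| ≤ δ := by
    simpa using abs_sub_le_of_le_of_le hp.1.1 hp.1.2 hq.1.1 hq.1.2
  have h1 : |p 1 - q 1| ≤ δ := by
    simpa using abs_sub_le_of_le_of_le hp.2.1 hp.2.2 hq.2.1 hq.2.2
  rw [edist_dist, EuclideanSpace.dist_eq, Fin.sum_univ_two, Real.dist_eq, Real.dist_eq]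
  refine ENNReal.ofReal_le_ofReal (Real.sqrt_le_iff.2 ⟨?_, ?_⟩) <;>
    nlinarith [abs_nonneg (p 0 - q 0), abs_nonneg (p 1 - q 1)]

theorem subset_planeProd_Icc {E : Set (EuclideanSpace ℝ (Fin 2))} {r : ℝ} (hr : 0 ≤ r)
    (hE : Metric.ediam E ≤ ENNReal.ofReal r) {p : EuclideanSpace ℝ (Fin 2)} (hp : p ∈ E) :
    E ⊆ planeProd (Set.Icc (p 0 - r) (p 0 + r)) (Set.Icc (p 1 - r) (p 1 + r)) := by
  intro q hq
  have hdist : dist q p ≤ r := by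
    rw [← ENNReal.ofReal_le_ofReal_iff hr, ← edist_dist]
    exact (Metric.edist_le_ediam_of_mem hq hp).trans hE
  have hcoord (i : Fin 2) : q i ∈ Set.Icc (p i - r) (p i + r) := by
    rw [← Real.closedBall_eq_Icc]
    exact (PiLp.dist_apply_le q p i).trans hdist
  exact ⟨hcoord 0, hcoord 1⟩

theorem one_add_le_dimH_of_planeProd_subset {ν : Measure ℝ} [SFinite ν] {ρ D t : ℝ}
    (hρ0 : 0 < ρ) (hρ1 : ρ < 1)
    (hν : ∀ (n : ℕ) (y : ℝ),
      ν (Set.Icc (y - ρ ^ n) (y + ρ ^ n)) ≤ ENNReal.ofReal (D * (ρ ^ n) ^ t))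
    {I J : Set ℝ} (hI : volume I ≠ 0) (hJ : ν J ≠ 0) {S : Set (EuclideanSpace ℝ (Fin 2))}
    (hS : planeProd I J ⊆ S) : ENNReal.ofReal (1 + t) ≤ dimH S := by
  set mk : ℝ × ℝ → EuclideanSpace ℝ (Fin 2) := fun z => !₂[z.1, z.2]
  have hmk : Measurable mk := by fun_prop
  have hpreimage (A B : Set ℝ) : mk ⁻¹' planeProd A B = A ×ˢ B := by
    ext z; simp [mk, planeProd]
  refine le_dimH_of_measure_le_rpow (μ := (volume.prod ν).map mk) (D := 2 * D) hρ0 hρ1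
    (fun n E hE => ?_) ?_
  · rcases E.eq_empty_or_nonempty with rfl | ⟨p, hp⟩
    · simp
    calc (volume.prod ν).map mk E
        ≤ (volume.prod ν).map mk (planeProd (Set.Icc (p 0 - ρ ^ n) (p 0 + ρ ^ n))
            (Set.Icc (p 1 - ρ ^ n) (p 1 + ρ ^ n))) :=
          measure_mono (subset_planeProd_Icc (by positivity) hE hp)
      _ = ENNReal.ofReal (2 * ρ ^ n) * ν (Set.Icc (p 1 - ρ ^ n) (p 1 + ρ ^ n)) := by
          rw [Measure.map_apply hmk (isClosed_planeProd isClosed_Icc isClosed_Icc).measurableSet,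
            hpreimage, Measure.prod_prod, Real.volume_Icc]
          ring_nf
      _ ≤ ENNReal.ofReal (2 * ρ ^ n) * ENNReal.ofReal (D * (ρ ^ n) ^ t) := by
          gcongr
          exact hν n (p 1)
      _ = ENNReal.ofReal (2 * D * (ρ ^ n) ^ (1 + t)) := by
          rw [← ENNReal.ofReal_mul (by positivity), Real.rpow_add (by positivity), Real.rpow_one]
          ring_nf
  · have hpos : 0 < (volume.prod ν) (I ×ˢ J) := by
      rw [Measure.prod_prod]
      exact ENNReal.mul_pos hI hJ
    refine (hpos.trans_le ?_).ne'
    rw [← hpreimage]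
    exact (measure_mono (Set.preimage_mono hS)).trans (Measure.le_map_apply hmk.aemeasurable S)

end Plane

section SelfSimilar

variable {ι : Type*} {ρ : ℝ} {b : ι → ℝ}

/-- The point with address `ω` in the self-similar set of the maps `y ↦ ρ * y + b i`. -/
noncomputable def addressPoint (ρ : ℝ) (b : ι → ℝ) (ω : ℕ → ι) : ℝ :=
  ∑' j, ρ ^ j * b (ω j)

/-- The image of `0` under the first `m` maps of the address `ω`; it approximates
`addressPoint ρ b ω`. -/
noncomputable def truncatedPoint (ρ : ℝ) (b : ι → ℝ) (m : ℕ) (ω : ℕ → ι) : ℝ :=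
  ∑ j ∈ Finset.range m, ρ ^ j * b (ω j)

theorem truncatedPoint_succ (m : ℕ) (ω : ℕ → ι) :
    truncatedPoint ρ b (m + 1) ω = ρ * truncatedPoint ρ b m (fun j => ω (j + 1)) + b (ω 0) := by
  rw [truncatedPoint, truncatedPoint, Finset.sum_range_succ', Finset.mul_sum, pow_zero, one_mul]
  simp only [pow_succ', mul_assoc]

theorem truncatedPoint_mem_Icc (hρ0 : 0 ≤ ρ) (hb : ∀ i, b i ∈ Set.Icc 0 (1 - ρ)) (m : ℕ)
    (ω : ℕ → ι) : truncatedPoint ρ b m ω ∈ Set.Icc 0 (1 - ρ ^ m) := by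
  induction m generalizing ω with
  | zero => simp [truncatedPoint]
  | succ m ih =>
    obtain ⟨hlow, hupp⟩ := ih fun j => ω (j + 1)
    rw [truncatedPoint_succ, pow_succ']
    exact ⟨add_nonneg (mul_nonneg hρ0 hlow) (hb _).1, by nlinarith [(hb (ω 0)).2]⟩

theorem pow_le_abs_truncatedPoint_sub (hρ0 : 0 ≤ ρ) (hb : ∀ i, b i ∈ Set.Icc 0 (1 - ρ))
    (hsep : Pairwise fun i j => ρ ≤ |b i - b j|) {m : ℕ} {ω ω' : ℕ → ι}
    (hω : ∃ j < m, ω j ≠ ω' j) :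
    ρ ^ m ≤ |truncatedPoint ρ b m ω - truncatedPoint ρ b m ω'| := by
  induction m generalizing ω ω' with
  | zero => simp at hω
  | succ m ih =>
    rw [truncatedPoint_succ, truncatedPoint_succ, pow_succ']
    by_cases hhead : ω 0 = ω' 0
    · have htail : ∃ j < m, ω (j + 1) ≠ ω' (j + 1) := by
        obtain ⟨_ | j, hj, hne⟩ := hω
        · exact absurd hhead hne
        · exact ⟨j, by omega, hne⟩
      rw [hhead, add_sub_add_right_eq_sub, ← mul_sub, abs_mul, abs_of_nonneg hρ0]
      exact mul_le_mul_of_nonneg_left (ih htail) hρ0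
    · set u := truncatedPoint ρ b m fun j => ω (j + 1)
      set v := truncatedPoint ρ b m fun j => ω' (j + 1)
      have huv : |v - u| ≤ 1 - ρ ^ m := by
        obtain ⟨hu0, hu1⟩ : u ∈ Set.Icc 0 (1 - ρ ^ m) := truncatedPoint_mem_Icc hρ0 hb _ _
        obtain ⟨hv0, hv1⟩ : v ∈ Set.Icc 0 (1 - ρ ^ m) := truncatedPoint_mem_Icc hρ0 hb _ _
        simpa using abs_sub_le_of_le_of_le hv0 hv1 hu0 hu1
      calc ρ * ρ ^ m ≤ ρ - ρ * |v - u| := by nlinarith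
        _ ≤ |b (ω 0) - b (ω' 0)| - |ρ * (v - u)| := by
            rw [abs_mul, abs_of_nonneg hρ0]
            exact sub_le_sub_right (hsep hhead) _
        _ ≤ |b (ω 0) - b (ω' 0) - ρ * (v - u)| := abs_sub_abs_le_abs_sub _ _
        _ = |ρ * u + b (ω 0) - (ρ * v + b (ω' 0))| := by ring_nf

section Limit

variable [Finite ι]

theorem summable_addressPoint (hρ0 : 0 ≤ ρ) (hρ1 : ρ < 1) (ω : ℕ → ι) :
    Summable fun j => ρ ^ j * b (ω j) := by
  obtain ⟨C, hC⟩ := Finite.exists_le fun i => ‖b i‖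
  refine .of_norm_bounded ((summable_geometric_of_lt_one hρ0 hρ1).mul_right C) fun j => ?_
  rw [norm_mul, Real.norm_of_nonneg (pow_nonneg hρ0 j)]
  exact mul_le_mul_of_nonneg_left (hC _) (pow_nonneg hρ0 j)

theorem tendsto_truncatedPoint (hρ0 : 0 ≤ ρ) (hρ1 : ρ < 1) (ω : ℕ → ι) :
    Tendsto (truncatedPoint ρ b · ω) atTop (𝓝 (addressPoint ρ b ω)) :=
  (summable_addressPoint hρ0 hρ1 ω).hasSum.tendsto_sum_nat

theorem addressPoint_eq (hρ0 : 0 ≤ ρ) (hρ1 : ρ < 1) (ω : ℕ → ι) :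
    addressPoint ρ b ω = ρ * addressPoint ρ b (fun j => ω (j + 1)) + b (ω 0) := by
  refine tendsto_nhds_unique ((tendsto_truncatedPoint hρ0 hρ1 ω).comp (tendsto_add_atTop_nat 1)) ?_
  simpa only [Function.comp_def, truncatedPoint_succ] using
    ((tendsto_truncatedPoint hρ0 hρ1 _).const_mul ρ).add_const (b (ω 0))

theorem addressPoint_mem_Icc (hρ0 : 0 ≤ ρ) (hρ1 : ρ < 1) (hb : ∀ i, b i ∈ Set.Icc 0 (1 - ρ))
    (ω : ℕ → ι) : addressPoint ρ b ω ∈ Set.Icc 0 1 := by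
  refine isClosed_Icc.mem_of_tendsto (tendsto_truncatedPoint hρ0 hρ1 ω) (.of_forall fun m => ?_)
  exact Set.Icc_subset_Icc_right (sub_le_self _ (pow_nonneg hρ0 m))
    (truncatedPoint_mem_Icc hρ0 hb m ω)

theorem addressPoint_sub_truncatedPoint_mem_Icc (hρ0 : 0 ≤ ρ) (hρ1 : ρ < 1)
    (hb : ∀ i, b i ∈ Set.Icc 0 (1 - ρ)) (m : ℕ) (ω : ℕ → ι) :
    addressPoint ρ b ω - truncatedPoint ρ b m ω ∈ Set.Icc 0 (ρ ^ m) := by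
  induction m generalizing ω with
  | zero => simpa [truncatedPoint] using addressPoint_mem_Icc hρ0 hρ1 hb ω
  | succ m ih =>
    obtain ⟨hlow, hupp⟩ := ih fun j => ω (j + 1)
    rw [addressPoint_eq hρ0 hρ1, truncatedPoint_succ, add_sub_add_right_eq_sub, ← mul_sub,
      pow_succ']
    exact ⟨mul_nonneg hρ0 hlow, mul_le_mul_of_nonneg_left hupp hρ0⟩

theorem measurable_addressPoint [MeasurableSpace ι] [MeasurableSingletonClass ι] (hρ0 : 0 ≤ ρ)
    (hρ1 : ρ < 1) : Measurable (addressPoint ρ b) := by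
  refine measurable_of_tendsto_metrizable (f := truncatedPoint ρ b) (fun m => ?_)
    (tendsto_pi_nhds.2 (tendsto_truncatedPoint hρ0 hρ1))
  unfold truncatedPoint
  fun_prop

end Limit

section Bernoulli

variable [Fintype ι] [Nonempty ι] [MeasurableSpace ι] [MeasurableSingletonClass ι]

/-- The uniform Bernoulli measure on addresses, under which the digits are independent and
uniformly distributed. -/
noncomputable def bernoulliMeasure (ι : Type*) [Fintype ι] [Nonempty ι] [MeasurableSpace ι] :
    Measure (ℕ → ι) :=
  Measure.infinitePi fun _ => (PMF.uniformOfFintype ι).toMeasure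

instance : IsProbabilityMeasure (bernoulliMeasure ι) :=
  inferInstanceAs (IsProbabilityMeasure (Measure.infinitePi _))

theorem bernoulliMeasure_cylinder (ω : ℕ → ι) (m : ℕ) :
    bernoulliMeasure ι {ω' | ∀ j < m, ω' j = ω j} = (Fintype.card ι : ℝ≥0∞)⁻¹ ^ m := by
  have hpi : {ω' | ∀ j < m, ω' j = ω j} = Set.pi (Finset.range m) fun j => {ω j} := by
    ext; simp
  rw [hpi, bernoulliMeasure, Measure.infinitePi_pi _ fun _ _ => measurableSet_singleton _]
  simp only [PMF.toMeasure_apply_singleton _ _ (measurableSet_singleton _),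
    PMF.uniformOfFintype_apply, Finset.prod_const, Finset.card_range]

-- By separation, the cell of the grid of mesh `ρ ^ m` containing `truncatedPoint ρ b m ω`
-- determines the first `m` digits of `ω`.
theorem bernoulliMeasure_floor_truncatedPoint_eq_le (hρ0 : 0 < ρ)
    (hb : ∀ i, b i ∈ Set.Icc 0 (1 - ρ)) (hsep : Pairwise fun i j => ρ ≤ |b i - b j|) (m : ℕ)
    (k : ℤ) : bernoulliMeasure ι {ω | ⌊truncatedPoint ρ b m ω / ρ ^ m⌋ = k} ≤
      (Fintype.card ι : ℝ≥0∞)⁻¹ ^ m := by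
  rcases Set.eq_empty_or_nonempty {ω | ⌊truncatedPoint ρ b m ω / ρ ^ m⌋ = k} with h | ⟨ω, hω⟩
  · simp [h]
  rw [← bernoulliMeasure_cylinder ω m]
  refine measure_mono fun ω' hω' => ?_
  by_contra! hne
  have hclose := Int.abs_sub_lt_one_of_floor_eq_floor (hω'.trans hω.symm)
  rw [← sub_div, abs_div, abs_of_pos (pow_pos hρ0 m), div_lt_one (pow_pos hρ0 m)] at hclose
  exact hclose.not_ge (pow_le_abs_truncatedPoint_sub hρ0.le hb hsep (by simpa using hne))

theorem map_addressPoint_bernoulliMeasure_Icc_le (hρ0 : 0 < ρ) (hρ1 : ρ < 1)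
    (hb : ∀ i, b i ∈ Set.Icc 0 (1 - ρ)) (hsep : Pairwise fun i j => ρ ≤ |b i - b j|) (m : ℕ)
    (y : ℝ) : (bernoulliMeasure ι).map (addressPoint ρ b) (Set.Icc (y - ρ ^ m) (y + ρ ^ m)) ≤
      4 * (Fintype.card ι : ℝ≥0∞)⁻¹ ^ m := by
  have hρm : 0 < ρ ^ m := pow_pos hρ0 m
  rw [Measure.map_apply (measurable_addressPoint hρ0.le hρ1) measurableSet_Icc]
  set k := ⌊y / ρ ^ m⌋
  have hcover : addressPoint ρ b ⁻¹' Set.Icc (y - ρ ^ m) (y + ρ ^ m) ⊆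
      ⋃ i ∈ Finset.Icc (k - 2) (k + 1), {ω | ⌊truncatedPoint ρ b m ω / ρ ^ m⌋ = i} := by
    intro ω hω
    obtain ⟨hlow, hupp⟩ := addressPoint_sub_truncatedPoint_mem_Icc hρ0.le hρ1 hb m ω
    have hlow' : y / ρ ^ m - 2 ≤ truncatedPoint ρ b m ω / ρ ^ m := by
      rw [le_div_iff₀ hρm, sub_mul, div_mul_cancel₀ _ hρm.ne']
      linarith [hω.1]
    have hupp' : truncatedPoint ρ b m ω / ρ ^ m ≤ y / ρ ^ m + 1 := by
      rw [div_le_iff₀ hρm, add_mul, div_mul_cancel₀ _ hρm.ne']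
      linarith [hω.2]
    simp only [Set.mem_iUnion, Finset.mem_Icc]
    refine ⟨_, ⟨?_, ?_⟩, rfl⟩
    · simpa using Int.floor_mono hlow'
    · simpa using Int.floor_mono hupp'
  calc bernoulliMeasure ι (addressPoint ρ b ⁻¹' Set.Icc (y - ρ ^ m) (y + ρ ^ m))
      ≤ ∑ i ∈ Finset.Icc (k - 2) (k + 1),
          bernoulliMeasure ι {ω | ⌊truncatedPoint ρ b m ω / ρ ^ m⌋ = i} :=
        (measure_mono hcover).trans (measure_biUnion_finset_le _ _)
    _ ≤ ∑ _i ∈ Finset.Icc (k - 2) (k + 1), (Fintype.card ι : ℝ≥0∞)⁻¹ ^ m := by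
        gcongr with i
        exact bernoulliMeasure_floor_truncatedPoint_eq_le hρ0 hb hsep m i
    _ = 4 * (Fintype.card ι : ℝ≥0∞)⁻¹ ^ m := by
        have hcard : (k + 1 + 1 - (k - 2)).toNat = 4 := by omega
        rw [Finset.sum_const, Int.card_Icc, hcard, nsmul_eq_mul, Nat.cast_ofNat]

end Bernoulli

theorem one_add_le_dimH_of_planeProd_range_addressPoint_subset [Fintype ι] [Nonempty ι]
    (hρ0 : 0 < ρ) (hρ1 : ρ < 1) (hb : ∀ i, b i ∈ Set.Icc 0 (1 - ρ))
    (hsep : Pairwise fun i j => ρ ≤ |b i - b j|) {t : ℝ}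
    (hcard : (Fintype.card ι : ℝ)⁻¹ ≤ ρ ^ t) {I : Set ℝ} (hI : volume I ≠ 0)
    {S : Set (EuclideanSpace ℝ (Fin 2))}
    (hS : planeProd I (Set.range (addressPoint ρ b)) ⊆ S) : ENNReal.ofReal (1 + t) ≤ dimH S := by
  let _ : MeasurableSpace ι := ⊤
  have hmeas : Measurable (addressPoint ρ b) := measurable_addressPoint hρ0.le hρ1
  refine one_add_le_dimH_of_planeProd_subset (ν := (bernoulliMeasure ι).map (addressPoint ρ b))
    (D := 4) hρ0 hρ1 (fun m y => ?_) hI ?_ hS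
  · have hcard' : (Fintype.card ι : ℝ≥0∞)⁻¹ ≤ ENNReal.ofReal (ρ ^ t) := by
      rw [← ENNReal.ofReal_natCast, ← ENNReal.ofReal_inv_of_pos (by positivity)]
      exact ENNReal.ofReal_le_ofReal hcard
    calc (bernoulliMeasure ι).map (addressPoint ρ b) (Set.Icc (y - ρ ^ m) (y + ρ ^ m))
        ≤ 4 * (Fintype.card ι : ℝ≥0∞)⁻¹ ^ m :=
          map_addressPoint_bernoulliMeasure_Icc_le hρ0 hρ1 hb hsep m y
      _ ≤ 4 * ENNReal.ofReal (ρ ^ t) ^ m := by gcongr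
      _ = ENNReal.ofReal (4 * (ρ ^ m) ^ t) := by
          rw [← ENNReal.ofReal_pow (by positivity), Real.rpow_pow_comm hρ0.le,
            ENNReal.ofReal_mul (by norm_num), ENNReal.ofReal_ofNat]
  · have hfull := Measure.le_map_apply (μ := bernoulliMeasure ι) hmeas.aemeasurable
      (Set.range (addressPoint ρ b))
    rw [Set.preimage_range, measure_univ] at hfull
    exact (one_pos.trans_le hfull).ne'

end SelfSimilar

theorem le_inv_iff_mul_le_one_of_pos {x β : ℝ} (hβ0 : 0 < β) : x ≤ β⁻¹ ↔ β * x ≤ 1 := by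
  rw [← le_inv_mul_iff₀ hβ0, mul_one]

theorem betaMap_div {β x : ℝ} (hβ0 : 0 < β) (hx : x ≤ 1) (τ y : ℝ) :
    betaMap β τ !₂[x / β, y] = !₂[x, τ * y] := by
  have hleft : x / β ≤ β⁻¹ := by
    rwa [div_eq_mul_inv, mul_le_iff_le_one_left (inv_pos.2 hβ0)]
  simp [betaMap, hleft, mul_div_cancel₀ x hβ0.ne']

theorem betaMap_add_one_div {β x : ℝ} (hβ0 : 0 < β) (hx : 0 < x) (τ y : ℝ) :
    betaMap β τ !₂[(x + 1) / β, y] = !₂[x, τ * y + (1 - τ)] := by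
  have hright : ¬ (x + 1) / β ≤ β⁻¹ := by
    rw [div_eq_mul_inv, mul_le_iff_le_one_left (inv_pos.2 hβ0)]
    linarith
  simp [betaMap, hright, mul_div_cancel₀ (x + 1) hβ0.ne']

/-- A horizontal strip `[0, width] × [base, base + h]` of a height `h` to be specified, as they
occur in the images of the unit square under the iterates of `betaMap`. -/
structure BetaStrip where
  /-- The length of the strip, whose left end lies over `0`. -/
  width : ℝ
  /-- The height of the lower edge of the strip. -/
  base : ℝ

namespace BetaStrip

/-- The strip of height `h`, as a subset of the plane. -/
def region (h : ℝ) (s : BetaStrip) : Set (EuclideanSpace ℝ (Fin 2)) :=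
  planeProd (Set.Icc 0 s.width) (Set.Icc s.base (s.base + h))

/-- The strips into which `betaMap β τ` maps a strip: a strip reaching beyond `β⁻¹` is cut there,
and its left part is stretched to full width. -/
noncomputable def children (β τ : ℝ) (s : BetaStrip) : List BetaStrip :=
  if s.width ≤ β⁻¹ then [⟨β * s.width, τ * s.base⟩]
  else [⟨1, τ * s.base⟩, ⟨β * s.width - 1, τ * s.base + (1 - τ)⟩]

/-- Consecutive squares of side `h`, resting on the base line of a strip of height `h` and
covering it. -/
noncomputable def squares (h : ℝ) (s : BetaStrip) : List (Set (EuclideanSpace ℝ (Fin 2))) :=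
  (List.range (⌊s.width / h⌋₊ + 1)).map fun j : ℕ =>
    planeProd (Set.Icc ((j : ℝ) * h) (j * h + h)) (Set.Icc s.base (s.base + h))

variable {β τ h : ℝ} {r s : BetaStrip}

theorem region_subset_iUnion_squares (hh : 0 < h) : s.region h ⊆ ⋃ U ∈ s.squares h, U := by
  rintro p ⟨⟨hp0, hp1⟩, hpy⟩
  have hj : ⌊p 0 / h⌋₊ < ⌊s.width / h⌋₊ + 1 :=
    Nat.lt_succ_of_le (Nat.floor_mono (div_le_div_of_nonneg_right hp1 hh.le))
  refine Set.mem_biUnion (List.mem_map_of_mem (List.mem_range.2 hj)) ⟨⟨?_, ?_⟩, hpy⟩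
  · exact (le_div_iff₀ hh).1 (Nat.floor_le (div_nonneg hp0 hh.le))
  · rw [← add_one_mul]
    exact (div_le_iff₀ hh).1 (Nat.lt_floor_add_one _).le

theorem ediam_le_of_mem_squares {U : Set (EuclideanSpace ℝ (Fin 2))} (hU : U ∈ s.squares h) :
    Metric.ediam U ≤ ENNReal.ofReal (2 * h) := by
  obtain ⟨j, -, rfl⟩ := List.mem_map.1 hU
  exact ediam_planeProd_Icc_le _ _ _

theorem length_squares_le (hs : 0 ≤ s.width) (hh : 0 ≤ h) :
    ((s.squares h).length : ℝ) ≤ s.width / h + 1 := by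
  rw [squares, List.length_map, List.length_range, Nat.cast_add_one]
  exact add_le_add_left (Nat.floor_le (div_nonneg hs hh)) 1

theorem sum_width_children (β τ : ℝ) (s : BetaStrip) :
    ((s.children β τ).map width).sum = β * s.width := by
  unfold children
  split_ifs <;> simp

theorem length_children_le (β τ : ℝ) (s : BetaStrip) : (s.children β τ).length ≤ 2 := by
  unfold children
  split_ifs <;> simp

theorem length_children_le_one_add_countP (β τ : ℝ) (s : BetaStrip) :
    (s.children β τ).length ≤ 1 + (s.children β τ).countP (·.width = 1) := by
  unfold children
  split_ifs
  · simp
  · rw [List.countP_cons_of_pos (by simp)]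
    simp only [List.length_cons, List.length_nil]
    omega

theorem width_mem_Ioc_of_mem_children (hβ0 : 0 < β) (hβ2 : β ≤ 2) (hs : s.width ∈ Set.Ioc 0 1)
    (hr : r ∈ s.children β τ) : r.width ∈ Set.Ioc 0 1 := by
  unfold children at hr
  split_ifs at hr with hcut
  · obtain rfl := List.mem_singleton.1 hr
    exact ⟨mul_pos hβ0 hs.1, (le_inv_iff_mul_le_one_of_pos hβ0).1 hcut⟩
  · have hcut' : 1 < β * s.width := (inv_lt_iff_one_lt_mul₀' hβ0).1 (not_le.1 hcut)
    rcases List.mem_pair.1 hr with rfl | rfl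
    · simp
    · exact ⟨by simpa using hcut', by nlinarith [hs.2]⟩

theorem base_eq_of_mem_children (hr : r ∈ s.children β τ) :
    r.base = τ * s.base ∨ r.base = τ * s.base + (1 - τ) := by
  unfold children at hr
  split_ifs at hr
  · obtain rfl := List.mem_singleton.1 hr
    exact .inl rfl
  · rcases List.mem_pair.1 hr with rfl | rfl
    · exact .inl rfl
    · exact .inr rfl

theorem base_mem_Icc_of_mem_children (hτ0 : 0 ≤ τ) (hτ1 : τ ≤ 1)
    (hs : s.base ∈ Set.Icc 0 (1 - h)) (hr : r ∈ s.children β τ) :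
    r.base ∈ Set.Icc 0 (1 - τ * h) := by
  have hlow : 0 ≤ τ * s.base := mul_nonneg hτ0 hs.1
  have hupp : τ * s.base ≤ τ * (1 - h) := mul_le_mul_of_nonneg_left hs.2 hτ0
  rcases base_eq_of_mem_children hr with hr | hr <;> rw [hr] <;> constructor <;> linarith

theorem exists_betaMap_mem_region_children (hβ0 : 0 < β) (hτ0 : 0 ≤ τ)
    {p : EuclideanSpace ℝ (Fin 2)} (hp : p ∈ s.region h) :
    ∃ r ∈ s.children β τ, betaMap β τ p ∈ r.region (τ * h) := by
  obtain ⟨⟨hx0, hx1⟩, hy0, hy1⟩ := hp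
  have hx0' : 0 ≤ β * p 0 := mul_nonneg hβ0.le hx0
  have hx1' : β * p 0 ≤ β * s.width := mul_le_mul_of_nonneg_left hx1 hβ0.le
  have hy0' : τ * s.base ≤ τ * p 1 := mul_le_mul_of_nonneg_left hy0 hτ0
  have hy1' : τ * p 1 ≤ τ * s.base + τ * h := by
    rw [← mul_add]
    exact mul_le_mul_of_nonneg_left hy1 hτ0
  have hcut : p 0 ≤ β⁻¹ ↔ β * p 0 ≤ 1 := le_inv_iff_mul_le_one_of_pos hβ0
  unfold betaMap children
  split_ifs with hshort hleft hleft
  · exact ⟨_, List.mem_singleton_self _, ⟨hx0', hx1'⟩, hy0', hy1'⟩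
  · exact absurd (hx1.trans hshort) hleft
  · exact ⟨_, List.mem_cons_self, ⟨hx0', hcut.1 hleft⟩, hy0', hy1'⟩
  · have hright : 1 < β * p 0 := not_le.1 (mt hcut.2 hleft)
    refine ⟨_, List.mem_cons_of_mem _ (List.mem_singleton_self _), ⟨?_, ?_⟩, ?_, ?_⟩
    · exact (sub_pos.2 hright).le
    · exact sub_le_sub_right hx1' 1
    · exact add_le_add_left hy0' _
    · exact (add_le_add_left hy1' _).trans_eq (add_right_comm _ _ _)

theorem exists_betaMap_eq_of_mem_children (hβ0 : 0 < β) (hr : r ∈ s.children β τ) {x : ℝ}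
    (hx : x ∈ Set.Ioc 0 r.width) : ∃ x' ∈ Set.Ioc 0 s.width, ∀ z : ℝ,
      betaMap β τ !₂[x', z + s.base] = !₂[x, τ * z + r.base] := by
  have left (hx1 : x ≤ 1) (hxs : x ≤ β * s.width) : ∃ x' ∈ Set.Ioc 0 s.width, ∀ z : ℝ,
      betaMap β τ !₂[x', z + s.base] = !₂[x, τ * z + τ * s.base] :=
    ⟨x / β, ⟨div_pos hx.1 hβ0, (div_le_iff₀' hβ0).2 hxs⟩, fun z => by
      rw [betaMap_div hβ0 hx1, mul_add]⟩
  have right (hxs : x + 1 ≤ β * s.width) : ∃ x' ∈ Set.Ioc 0 s.width, ∀ z : ℝ,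
      betaMap β τ !₂[x', z + s.base] = !₂[x, τ * z + (τ * s.base + (1 - τ))] :=
    ⟨(x + 1) / β, ⟨div_pos (add_pos hx.1 one_pos) hβ0, (div_le_iff₀' hβ0).2 hxs⟩, fun z => by
      rw [betaMap_add_one_div hβ0 hx.1, mul_add, add_assoc]⟩
  have hcut : s.width ≤ β⁻¹ ↔ β * s.width ≤ 1 := le_inv_iff_mul_le_one_of_pos hβ0
  unfold children at hr
  split_ifs at hr with hshort
  · obtain rfl := List.mem_singleton.1 hr
    exact left (hx.2.trans (hcut.1 hshort)) hx.2
  · rcases List.mem_pair.1 hr with rfl | rfl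
    · exact left hx.2 (hx.2.trans (not_le.1 (mt hcut.2 hshort)).le)
    · exact right (le_sub_iff_add_le.1 hx.2)

end BetaStrip

/-- The strips making up the `n`-th image of the unit square, each of height `τ ^ n`. -/
noncomputable def betaStrips (β τ : ℝ) : ℕ → List BetaStrip
  | 0 => [⟨1, 0⟩]
  | n + 1 => (betaStrips β τ n).flatMap (BetaStrip.children β τ)

/-- The strips of the `n`-th image of the unit square that run across the whole square; inside such
a strip the same picture repeats, scaled down by `τ ^ n` in the vertical direction. -/
noncomputable def fullStrips (β τ : ℝ) (n : ℕ) : List BetaStrip :=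
  (betaStrips β τ n).filter (·.width = 1)

section Strips

variable {β τ : ℝ} {n : ℕ} {s : BetaStrip}

theorem width_mem_Ioc_of_mem_betaStrips (hβ0 : 0 < β) (hβ2 : β ≤ 2) (hs : s ∈ betaStrips β τ n) :
    s.width ∈ Set.Ioc 0 1 := by
  induction n generalizing s with
  | zero =>
    obtain rfl := List.mem_singleton.1 hs
    simp
  | succ n ih =>
    obtain ⟨r, hr, hsr⟩ := List.mem_flatMap.1 hs
    exact BetaStrip.width_mem_Ioc_of_mem_children hβ0 hβ2 (ih hr) hsr

theorem base_mem_Icc_of_mem_betaStrips (hτ0 : 0 ≤ τ) (hτ1 : τ ≤ 1) (hs : s ∈ betaStrips β τ n) :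
    s.base ∈ Set.Icc 0 (1 - τ ^ n) := by
  induction n generalizing s with
  | zero =>
    obtain rfl := List.mem_singleton.1 hs
    simp
  | succ n ih =>
    obtain ⟨r, hr, hsr⟩ := List.mem_flatMap.1 hs
    rw [pow_succ']
    exact BetaStrip.base_mem_Icc_of_mem_children hτ0 hτ1 (ih hr) hsr

theorem sum_width_betaStrips (β τ : ℝ) (n : ℕ) :
    ((betaStrips β τ n).map BetaStrip.width).sum = β ^ n := by
  induction n with
  | zero => simp [betaStrips]
  | succ n ih =>
    rw [betaStrips, List.map_flatMap, List.flatMap_def, List.sum_flatten, List.map_map,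
      pow_succ', ← ih, ← List.sum_map_mul_left]
    simp only [Function.comp_def, BetaStrip.sum_width_children]

theorem length_betaStrips_le_two_pow (β τ : ℝ) (n : ℕ) : (betaStrips β τ n).length ≤ 2 ^ n := by
  induction n with
  | zero => simp [betaStrips]
  | succ n ih =>
    calc (betaStrips β τ (n + 1)).length
        = ((betaStrips β τ n).map fun s => (s.children β τ).length).sum := List.length_flatMap
      _ ≤ ((betaStrips β τ n).map fun _ => 2).sum :=
          List.sum_le_sum fun s _ => BetaStrip.length_children_le β τ s
      _ ≤ 2 ^ (n + 1) := by simpa [pow_succ] using ih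

theorem length_betaStrips_succ_le (β τ : ℝ) (n : ℕ) :
    (betaStrips β τ (n + 1)).length ≤
      (betaStrips β τ n).length + (fullStrips β τ (n + 1)).length := by
  calc (betaStrips β τ (n + 1)).length
      = ((betaStrips β τ n).map fun s => (s.children β τ).length).sum := List.length_flatMap
    _ ≤ ((betaStrips β τ n).map fun s =>
          1 + (s.children β τ).countP (·.width = 1)).sum :=
        List.sum_le_sum fun s _ => BetaStrip.length_children_le_one_add_countP β τ s
    _ = (betaStrips β τ n).length + (fullStrips β τ (n + 1)).length := by
        rw [List.sum_map_add, fullStrips, ← List.countP_eq_length_filter, betaStrips,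
          List.countP_flatMap]
        simp [Function.comp_def]

theorem length_betaStrips_le_sum_length_fullStrips (β τ : ℝ) (n : ℕ) :
    (betaStrips β τ n).length ≤ ∑ i ∈ Finset.range (n + 1), (fullStrips β τ i).length := by
  induction n with
  | zero => simp [betaStrips, fullStrips]
  | succ n ih =>
    rw [Finset.sum_range_succ]
    exact (length_betaStrips_succ_le β τ n).trans (Nat.add_le_add_right ih _)

theorem pow_le_length_betaStrips (hβ0 : 0 < β) (hβ2 : β ≤ 2) (τ : ℝ) (n : ℕ) :
    β ^ n ≤ ((betaStrips β τ n).length : ℝ) := by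
  rw [← sum_width_betaStrips β τ n]
  refine (List.sum_le_card_nsmul _ 1 fun x hx => ?_).trans_eq (by simp)
  obtain ⟨s, hs, rfl⟩ := List.mem_map.1 hx
  exact (width_mem_Ioc_of_mem_betaStrips hβ0 hβ2 hs).2

theorem exists_pow_le_length_fullStrips (hβ0 : 0 < β) (hβ2 : β ≤ 2) (τ : ℝ) {γ : ℝ}
    (hγ1 : 1 ≤ γ) (hγ : γ < β) :
    ∃ k ≠ 0, γ ^ k ≤ ((fullStrips β τ k).length : ℝ) := by
  by_contra! hfew
  have hpoly (n : ℕ) : β ^ n ≤ (n + 1) * γ ^ n :=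
    calc β ^ n ≤ ∑ i ∈ Finset.range (n + 1), ((fullStrips β τ i).length : ℝ) :=
          (pow_le_length_betaStrips hβ0 hβ2 τ n).trans
            (mod_cast length_betaStrips_le_sum_length_fullStrips β τ n)
      _ ≤ ∑ _i ∈ Finset.range (n + 1), γ ^ n := by
          refine Finset.sum_le_sum fun i hi => ?_
          rcases eq_or_ne i 0 with rfl | hi0
          · simpa [fullStrips, betaStrips] using one_le_pow₀ hγ1
          · exact (hfew i hi0).le.trans (pow_le_pow_right₀ hγ1 (Finset.mem_range_succ_iff.1 hi))
      _ = (n + 1) * γ ^ n := by simp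
  have hlim : Tendsto (fun n : ℕ => (n : ℝ) * (γ / β) ^ n + (γ / β) ^ n) atTop (𝓝 (0 + 0)) := by
    have hratio0 : 0 ≤ γ / β := by positivity
    have hratio1 : γ / β < 1 := (div_lt_one hβ0).2 hγ
    exact (tendsto_self_mul_const_pow_of_lt_one hratio0 hratio1).add
      (tendsto_pow_atTop_nhds_zero_of_lt_one hratio0 hratio1)
  obtain ⟨n, hn⟩ := (hlim.eventually_lt_const (u := 1) (by norm_num)).exists
  rw [← add_one_mul, div_pow, ← mul_div_assoc, div_lt_one (by positivity)] at hn
  exact (hpoly n).not_gt hn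

theorem pairwise_pow_le_abs_base_sub (β : ℝ) (hτ0 : 0 ≤ τ) (hτ2 : τ ≤ 1 / 2) (n : ℕ) :
    (betaStrips β τ n).Pairwise fun s r => τ ^ n ≤ |s.base - r.base| := by
  induction n with
  | zero => simp [betaStrips]
  | succ n ih =>
    have far {s s' : BetaStrip} (hs : s ∈ betaStrips β τ n) (hs' : s' ∈ betaStrips β τ n) :
        τ ^ (n + 1) ≤ τ * s.base + (1 - τ) - τ * s'.base := by
      have hlow := (base_mem_Icc_of_mem_betaStrips hτ0 (by linarith) hs).1
      have hupp := (base_mem_Icc_of_mem_betaStrips hτ0 (by linarith) hs').2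
      rw [pow_succ']
      nlinarith
    refine List.pairwise_flatMap.2 ⟨fun s hs => ?_, ih.imp_of_mem ?_⟩
    · unfold BetaStrip.children
      split_ifs
      · exact List.pairwise_singleton _ _
      · rw [List.pairwise_pair, abs_sub_comm]
        exact (far hs hs).trans (le_abs_self _)
    · intro s s' hs hs' hsep r hr r' hr'
      have near : τ ^ (n + 1) ≤ |τ * s.base - τ * s'.base| := by
        rw [← mul_sub, abs_mul, abs_of_nonneg hτ0, pow_succ']
        exact mul_le_mul_of_nonneg_left hsep hτ0
      rcases BetaStrip.base_eq_of_mem_children hr with hr | hr <;>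
        rcases BetaStrip.base_eq_of_mem_children hr' with hr' | hr' <;> rw [hr, hr']
      · exact near
      · rw [abs_sub_comm]
        exact (far hs' hs).trans (le_abs_self _)
      · exact (far hs hs').trans (le_abs_self _)
      · rwa [add_sub_add_right_eq_sub]

theorem pairwise_pow_le_abs_base_sub_fullStrips (hτ0 : 0 ≤ τ) (hτ2 : τ ≤ 1 / 2) :
    Pairwise fun i j : Fin (fullStrips β τ n).length =>
      τ ^ n ≤ |((fullStrips β τ n).get i).base - ((fullStrips β τ n).get j).base| := by
  have : Std.Symm fun s r : BetaStrip => τ ^ n ≤ |s.base - r.base| :=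
    ⟨fun s r hsr => hsr.trans_eq (abs_sub_comm _ _)⟩
  exact (Std.Symm.pairwise_on _).2
    (List.pairwise_iff_get.1 ((pairwise_pow_le_abs_base_sub β hτ0 hτ2 n).filter _))

theorem exists_iterate_betaMap_mem_region (hβ0 : 0 < β) (hτ0 : 0 ≤ τ) (n : ℕ)
    {p : EuclideanSpace ℝ (Fin 2)} (hp : p ∈ unitSquare) :
    ∃ s ∈ betaStrips β τ n, (betaMap β τ)^[n] p ∈ s.region (τ ^ n) := by
  induction n with
  | zero => exact ⟨_, List.mem_singleton_self _, hp.1, by simpa using hp.2⟩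
  | succ n ih =>
    obtain ⟨s, hs, hps⟩ := ih
    obtain ⟨r, hr, hpr⟩ := BetaStrip.exists_betaMap_mem_region_children hβ0 hτ0 hps
    rw [Function.iterate_succ_apply', pow_succ']
    exact ⟨r, List.mem_flatMap_of_mem hs hr, hpr⟩

theorem mapsTo_iterate_betaMap_unitSquare (hβ0 : 0 < β) (hβ2 : β ≤ 2) (hτ0 : 0 ≤ τ) (hτ1 : τ ≤ 1)
    (n : ℕ) : Set.MapsTo (betaMap β τ)^[n] unitSquare unitSquare := by
  intro p hp
  obtain ⟨s, hs, hx, hy⟩ := exists_iterate_betaMap_mem_region hβ0 hτ0 n hp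
  obtain ⟨hlow, hupp⟩ := base_mem_Icc_of_mem_betaStrips hτ0 hτ1 hs
  exact ⟨Set.Icc_subset_Icc_right (width_mem_Ioc_of_mem_betaStrips hβ0 hβ2 hs).2 hx,
    Set.Icc_subset_Icc hlow (le_sub_iff_add_le.1 hupp) hy⟩

theorem exists_iterate_betaMap_eq_of_mem_betaStrips (hβ0 : 0 < β) (hs : s ∈ betaStrips β τ n)
    {x : ℝ} (hx : x ∈ Set.Ioc 0 s.width) : ∃ x' ∈ Set.Ioc (0 : ℝ) 1, ∀ y : ℝ,
      (betaMap β τ)^[n] !₂[x', y] = !₂[x, τ ^ n * y + s.base] := by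
  induction n generalizing s x with
  | zero =>
    obtain rfl := List.mem_singleton.1 hs
    exact ⟨x, hx, fun y => by simp⟩
  | succ n ih =>
    obtain ⟨r, hr, hsr⟩ := List.mem_flatMap.1 hs
    obtain ⟨z, hz, hstep⟩ := BetaStrip.exists_betaMap_eq_of_mem_children hβ0 hsr hx
    obtain ⟨x', hx', hiter⟩ := ih hr hz
    refine ⟨x', hx', fun y => ?_⟩
    rw [Function.iterate_succ_apply', hiter, hstep, pow_succ', mul_assoc]

end Strips

section Attractor

variable {β τ : ℝ}

theorem pow_rpow_logb_inv {γ : ℝ} (hτ0 : 0 < τ) (hτ1 : τ < 1) (hγ : 0 < γ) (n : ℕ) :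
    (τ ^ n) ^ Real.logb τ⁻¹ γ = (γ ^ n)⁻¹ := by
  rw [← Real.rpow_pow_comm hτ0.le, ← inv_pow, ← inv_inv (τ ^ _), ← Real.inv_rpow hτ0.le,
    Real.rpow_logb (inv_pos.2 hτ0) (one_lt_inv₀ hτ0 |>.2 hτ1).ne' hγ]

theorem betaAttractor_subset_iUnion_region (hβ0 : 0 < β) (hτ0 : 0 ≤ τ) (n : ℕ) :
    betaAttractor β τ ⊆ ⋃ s ∈ betaStrips β τ n, s.region (τ ^ n) := by
  refine closure_minimal (fun p hp => ?_) ?_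
  · obtain ⟨q, hq, rfl⟩ := Set.mem_iInter.1 hp n
    simpa using exists_iterate_betaMap_mem_region hβ0 hτ0 n hq
  · exact (List.finite_toSet (betaStrips β τ n)).isClosed_biUnion fun s _ =>
      isClosed_planeProd isClosed_Icc isClosed_Icc

/-- The squares of side `τ ^ n` into which the strips of the `n`-th image are cut. -/
noncomputable def betaSquares (β τ : ℝ) (n : ℕ) : List (Set (EuclideanSpace ℝ (Fin 2))) :=
  (betaStrips β τ n).flatMap (BetaStrip.squares (τ ^ n))

theorem betaAttractor_subset_iUnion_betaSquares (hβ0 : 0 < β) (hτ0 : 0 < τ) (n : ℕ) :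
    betaAttractor β τ ⊆ ⋃ U ∈ betaSquares β τ n, U := by
  refine (betaAttractor_subset_iUnion_region hβ0 hτ0.le n).trans (Set.iUnion₂_subset fun s hs => ?_)
  refine (BetaStrip.region_subset_iUnion_squares (pow_pos hτ0 n)).trans ?_
  exact Set.biUnion_mono (fun U hU => List.mem_flatMap_of_mem hs hU) fun U _ => le_rfl

theorem length_betaSquares_le (hβ1 : 1 ≤ β) (hβ2 : β ≤ 2) (hτ0 : 0 < τ) (hτ2 : τ ≤ 1 / 2) (n : ℕ) :
    ((betaSquares β τ n).length : ℝ) ≤ 2 * (β / τ) ^ n := by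
  have hβ0 : 0 < β := by linarith
  have htwo : (2 : ℝ) ≤ β / τ := by
    rw [le_div_iff₀ hτ0]
    linarith
  calc ((betaSquares β τ n).length : ℝ)
      = ((betaStrips β τ n).map fun s => ((s.squares (τ ^ n)).length : ℝ)).sum := by
        rw [betaSquares, List.length_flatMap, Nat.cast_list_sum, List.map_map]
        rfl
    _ ≤ ((betaStrips β τ n).map fun s => s.width / τ ^ n + 1).sum :=
        List.sum_le_sum fun s hs => BetaStrip.length_squares_le
          (width_mem_Ioc_of_mem_betaStrips hβ0 hβ2 hs).1.le (pow_pos hτ0 n).le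
    _ = β ^ n / τ ^ n + (betaStrips β τ n).length := by
        rw [List.sum_map_add, ← sum_width_betaStrips β τ n]
        simp [div_eq_mul_inv, List.sum_map_mul_right]
    _ ≤ (β / τ) ^ n + (β / τ) ^ n := by
        rw [div_pow]
        gcongr
        rw [← div_pow]
        exact (mod_cast length_betaStrips_le_two_pow β τ n : _ ≤ (2 : ℝ) ^ n).trans (by gcongr)
    _ = 2 * (β / τ) ^ n := (two_mul _).symm

theorem dimH_betaAttractor_le (hβ1 : 1 ≤ β) (hβ2 : β ≤ 2) (hτ0 : 0 < τ) (hτ2 : τ ≤ 1 / 2) :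
    dimH (betaAttractor β τ) ≤ ENNReal.ofReal (1 + Real.logb τ⁻¹ β) := by
  classical
  have hβ0 : 0 < β := by linarith
  have hτ1 : τ < 1 := by linarith
  have hlogb : 0 ≤ Real.logb τ⁻¹ β := Real.logb_nonneg ((one_lt_inv₀ hτ0).2 hτ1) hβ1
  refine dimH_le_of_finite_covers (C := 2) (D := 2) hτ0.le hτ1 (by positivity) fun n =>
    ⟨(betaSquares β τ n).toFinset, ?_, fun U hU => ?_, ?_⟩
  · simpa using betaAttractor_subset_iUnion_betaSquares hβ0 hτ0 n
  · obtain ⟨s, -, hUs⟩ := List.mem_flatMap.1 (List.mem_toFinset.1 hU)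
    exact BetaStrip.ediam_le_of_mem_squares hUs
  · calc ((betaSquares β τ n).toFinset.card : ℝ) * (τ ^ n) ^ (1 + Real.logb τ⁻¹ β)
        ≤ 2 * (β / τ) ^ n * (τ ^ n) ^ (1 + Real.logb τ⁻¹ β) := by
          gcongr
          exact (Nat.cast_le.2 (List.toFinset_card_le _)).trans
            (length_betaSquares_le hβ1 hβ2 hτ0 hτ2 n)
      _ = 2 := by
          rw [Real.rpow_add (pow_pos hτ0 n), Real.rpow_one, pow_rpow_logb_inv hτ0 hτ1 hβ0, div_pow]
          field_simp

theorem addressPoint_mem_iterate_betaMap_image {k : ℕ} {ι : Type*} [Finite ι] {b : ι → ℝ}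
    (hβ0 : 0 < β) (hτ0 : 0 ≤ τ) (hτ1 : τ < 1) (hk : k ≠ 0)
    (hb : ∀ i, ⟨1, b i⟩ ∈ betaStrips β τ k) (m : ℕ) {x : ℝ} (hx : x ∈ Set.Ioc (0 : ℝ) 1)
    (ω : ℕ → ι) : !₂[x, addressPoint (τ ^ k) b ω] ∈ (betaMap β τ)^[k * m] '' unitSquare := by
  have hρ0 : 0 ≤ τ ^ k := pow_nonneg hτ0 k
  have hρ1 : τ ^ k < 1 := pow_lt_one₀ hτ0 hτ1 hk
  induction m generalizing x ω with
  | zero =>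
    exact ⟨_, ⟨Set.Ioc_subset_Icc_self hx, addressPoint_mem_Icc hρ0 hρ1
      (fun i => base_mem_Icc_of_mem_betaStrips hτ0 hτ1.le (hb i)) ω⟩, rfl⟩
  | succ m ih =>
    obtain ⟨x', hx', hiter⟩ := exists_iterate_betaMap_eq_of_mem_betaStrips hβ0 (hb (ω 0)) hx
    obtain ⟨q, hq, hqx'⟩ := ih hx' fun j => ω (j + 1)
    refine ⟨q, hq, ?_⟩
    rw [mul_add_one, add_comm, Function.iterate_add_apply, hqx', hiter, addressPoint_eq hρ0 hρ1 ω]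

theorem planeProd_range_addressPoint_subset_betaAttractor {k : ℕ} {ι : Type*} [Finite ι]
    {b : ι → ℝ} (hβ0 : 0 < β) (hβ2 : β ≤ 2) (hτ0 : 0 ≤ τ) (hτ1 : τ < 1) (hk : k ≠ 0)
    (hb : ∀ i, ⟨1, b i⟩ ∈ betaStrips β τ k) :
    planeProd (Set.Ioc 0 1) (Set.range (addressPoint (τ ^ k) b)) ⊆ betaAttractor β τ := by
  rintro p ⟨hx, ω, hω⟩
  have hp : p = !₂[p 0, addressPoint (τ ^ k) b ω] := by
    ext i
    fin_cases i
    · rfl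
    · exact hω.symm
  refine subset_closure (Set.mem_iInter.2 fun n => ?_)
  obtain ⟨q, hq, hqp⟩ := addressPoint_mem_iterate_betaMap_image hβ0 hτ0 hτ1 hk hb n hx ω
  obtain ⟨j, hj⟩ := Nat.exists_eq_add_of_le (Nat.le_mul_of_pos_left n (Nat.pos_of_ne_zero hk))
  rw [hj, Function.iterate_add_apply] at hqp
  exact ⟨_, mapsTo_iterate_betaMap_unitSquare hβ0 hβ2 hτ0 hτ1.le j hq, hqp.trans hp.symm⟩

theorem le_dimH_betaAttractor_of_lt (hβ2 : β ≤ 2) (hτ0 : 0 < τ) (hτ2 : τ ≤ 1 / 2) {γ : ℝ}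
    (hγ1 : 1 ≤ γ) (hγ : γ < β) :
    ENNReal.ofReal (1 + Real.logb τ⁻¹ γ) ≤ dimH (betaAttractor β τ) := by
  have hβ0 : 0 < β := by linarith
  have hγ0 : 0 < γ := by linarith
  have hτ1 : τ < 1 := by linarith
  obtain ⟨k, hk, hcard⟩ := exists_pow_le_length_fullStrips hβ0 hβ2 τ hγ1 hγ
  set l := fullStrips β τ k
  have hfull (i : Fin l.length) : ⟨1, (l.get i).base⟩ ∈ betaStrips β τ k := by
    obtain ⟨hmem, hwidth⟩ := List.mem_filter.1 (List.get_mem l i)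
    rwa [← of_decide_eq_true hwidth]
  have hsep : Pairwise fun i j : Fin l.length => τ ^ k ≤ |(l.get i).base - (l.get j).base| :=
    pairwise_pow_le_abs_base_sub_fullStrips hτ0.le hτ2
  have : Nonempty (Fin l.length) := by
    rw [← Fin.pos_iff_nonempty]
    exact_mod_cast (pow_pos hγ0 k).trans_le hcard
  refine one_add_le_dimH_of_planeProd_range_addressPoint_subset (pow_pos hτ0 k)
    (pow_lt_one₀ hτ0.le hτ1 hk)
    (fun i => base_mem_Icc_of_mem_betaStrips hτ0.le hτ1.le (hfull i)) hsep ?_ (by simp)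
    (planeProd_range_addressPoint_subset_betaAttractor hβ0 hβ2 hτ0.le hτ1 hk hfull)
  rw [Fintype.card_fin, pow_rpow_logb_inv hτ0 hτ1 hγ0]
  exact inv_anti₀ (pow_pos hγ0 k) hcard

theorem le_dimH_betaAttractor (hβ1 : 1 < β) (hβ2 : β ≤ 2) (hτ0 : 0 < τ) (hτ2 : τ ≤ 1 / 2) :
    ENNReal.ofReal (1 + Real.logb τ⁻¹ β) ≤ dimH (betaAttractor β τ) := by
  have hlim : Tendsto (fun γ => ENNReal.ofReal (1 + Real.logb τ⁻¹ γ)) (𝓝[<] β)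
      (𝓝 (ENNReal.ofReal (1 + Real.logb τ⁻¹ β))) := by
    have hcont : ContinuousAt (Real.logb τ⁻¹) β := Real.continuousAt_logb (by linarith)
    exact (ENNReal.tendsto_ofReal (hcont.tendsto.const_add 1)).mono_left nhdsWithin_le_nhds
  refine le_of_tendsto hlim ?_
  filter_upwards [Ioo_mem_nhdsLT hβ1] with γ hγ
  exact le_dimH_betaAttractor_of_lt hβ2 hτ0 hτ2 hγ.1.le hγ.2

end Attractor

theorem mainTheorem1_general {β τ : ℝ} (hβ : β ∈ Set.Ioc (1 : ℝ) 2)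
    (hτ : τ ∈ Set.Ioc (0 : ℝ) (1 / 2)) :
    dimH (betaAttractor β τ) = ENNReal.ofReal (1 + Real.log β / Real.log τ⁻¹) := by
  rw [Real.log_div_log]
  exact le_antisymm (dimH_betaAttractor_le hβ.1.le hβ.2 hτ.1 hτ.2)
    (le_dimH_betaAttractor hβ.1 hβ.2 hτ.1 hτ.2)

theorem mainTheorem1 (β τ : ℝ) (hβ : β ∈ Set.Ioo (1 : ℝ) 2) (hτ : τ ∈ Set.Ioo (0 : ℝ) (1 / 2)) :
    dimH (betaAttractor β τ) = ENNReal.ofReal (1 + Real.log β / Real.log τ⁻¹) :=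
  mainTheorem1_general (Set.Ioo_subset_Ioc_self hβ) (Set.Ioo_subset_Ioc_self hτ)
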